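/- Let $\mathcal B$ be a (small) bicategory and $b$ an object of $\mathcal B$. The comma bicategory $\mathcal B\!\downarrow_b$ of objects over $b$ has as objects the pairs $(f,a)$ with $a$ an object and $f:a\to b$ a 1-cell of $\mathcal B$; as 1-cells $(f,a)\to(f',a')$ the pairs $(\beta,u)$ with $u:a\to a'$ a 1-cell and $\beta:f\Rightarrow f'\circ u$ a (not necessarily invertible) 2-cell; and as 2-cells $(\beta,u)\Rightarrow(\beta',u')$ the 2-cells $\alpha:u\Rightarrow u'$ of $\mathcal B$ with $(1_{f'}\circ\alpha)\cdot\beta=\beta'$. The composite of $(\beta,u)$ and $(\gamma,v)$ is $v\circ u$ together with the pasting of $\beta$ and $\gamma$, the identity of $(f,a)$ is $1_a$ together with the unit constraint $f\cong f\circ 1_a$, and the compositions of 2-cells and the associativity and unit constraints are those of $\mathcal B$. The classifying space $\mathrm B\mathcal C$ of a bicategory $\mathcal C$ is the geometric realization of its (non-unitary) geometric nerve, the simplicial set whose $n$-simplices are all lax functors $[n]\to\mathcal C$, where $[n]=\{0<1<\dots<n\}$ is regarded as a bicategory with only identity 2-cells, and on which monotone maps act by precomposition. Then for every bicategory $\mathcal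 B$ and every object $b$ of $\mathcal B$, the space $\mathrm B(\mathcal B\!\downarrow_b)$ is contractible, i.e. homotopy equivalent to a point. -/

import Mathlib

open CategoryTheory Bicategory

universe w v u

/-! ### The comma bicategory of objects over a fixed object

Mathlib writes composites in diagrammatic order: `u ≫ v` is `v ∘ u`. -/

/-- An object of the comma bicategory `B ↓ b`: an object `pt` of `B` with a 1-cell `pt ⟶ b`. -/
structure CommaBicat {B : Type u} [Bicategory.{w, v} B] (b : B) where
  pt : B
  arr : pt ⟶ b

namespace CommaBicat

variable {B : Type u} [Bicategory.{w, v} B] {b : B}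

/-- A 1-cell `(β, u) : (f, a) ⟶ (f', a')` of `B ↓ b`: a 1-cell `u : a ⟶ a'` of `B` with a
(not necessarily invertible) 2-cell `β : f ⟶ f' ∘ u`. -/
structure Hom (X Y : CommaBicat b) where
  base : X.pt ⟶ Y.pt
  cell : X.arr ⟶ base ≫ Y.arr

/-- A 2-cell `(β, u) ⟶ (β', u')` of `B ↓ b`: a 2-cell `α : u ⟶ u'` of `B` such that pasting `α`
to `β` gives `β'`. -/
@[ext]
structure Hom₂ {X Y : CommaBicat b} (p q : Hom X Y) where
  base : p.base ⟶ q.base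
  w : p.cell ≫ base ▷ Y.arr = q.cell

/-- The identity 1-cell of `(f, a)` is `(r⁻¹ : f ⟶ f ∘ 1, 1)`; the composite of `(β, u)` and
`(γ, v)` is the pasting of `β` and `γ`, together with `v ∘ u`. -/
instance : CategoryStruct (CommaBicat b) where
  Hom X Y := Hom X Y
  id X := ⟨𝟙 X.pt, (λ_ X.arr).inv⟩
  comp {_ _ Z} p q :=
    ⟨p.base ≫ q.base, p.cell ≫ p.base ◁ q.cell ≫ (α_ p.base q.base Z.arr).inv⟩

@[simp] lemma id_base (X : CommaBicat b) : Hom.base (𝟙 X) = 𝟙 X.pt := rfl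

@[simp] lemma id_cell (X : CommaBicat b) : Hom.cell (𝟙 X) = (λ_ X.arr).inv := rfl

@[simp] lemma comp_base {X Y Z : CommaBicat b} (p : X ⟶ Y) (q : Y ⟶ Z) :
    Hom.base (p ≫ q) = Hom.base p ≫ Hom.base q := rfl

@[simp] lemma comp_cell {X Y Z : CommaBicat b} (p : X ⟶ Y) (q : Y ⟶ Z) :
    Hom.cell (p ≫ q) = Hom.cell p ≫ Hom.base p ◁ Hom.cell q ≫
      (α_ (Hom.base p) (Hom.base q) Z.arr).inv := rfl

/-- Vertical composition of 2-cells is that of `B`. -/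
instance homCategory (X Y : CommaBicat b) : Category.{w} (X ⟶ Y) where
  Hom p q := Hom₂ p q
  id p := ⟨𝟙 p.base, by simp⟩
  comp {p q r} η θ := ⟨η.base ≫ θ.base, by
    rw [comp_whiskerRight, ← Category.assoc, η.w, θ.w]⟩
  id_comp η := Hom₂.ext (Category.id_comp η.base)
  comp_id η := Hom₂.ext (Category.comp_id η.base)
  assoc η θ κ := Hom₂.ext (Category.assoc η.base θ.base κ.base)

@[ext] lemma hom₂_ext {X Y : CommaBicat b} {p q : X ⟶ Y} {η θ : p ⟶ q}
    (h : Hom₂.base η = Hom₂.base θ) : η = θ := Hom₂.ext h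

@[simp] lemma id_base₂ {X Y : CommaBicat b} (p : X ⟶ Y) :
    Hom₂.base (𝟙 p) = 𝟙 (Hom.base p) := rfl

@[simp] lemma comp_base₂ {X Y : CommaBicat b} {p q r : X ⟶ Y} (η : p ⟶ q) (θ : q ⟶ r) :
    Hom₂.base (η ≫ θ) = Hom₂.base η ≫ Hom₂.base θ := rfl

/-- An invertible 2-cell of `B` satisfying the 2-cell condition is invertible in `B ↓ b`. -/
@[simps]
def isoMk {X Y : CommaBicat b} {p q : X ⟶ Y} (e : Hom.base p ≅ Hom.base q)
    (h : Hom.cell p ≫ e.hom ▷ Y.arr = Hom.cell q) : p ≅ q where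
  hom := Hom₂.mk e.hom h
  inv := Hom₂.mk e.inv (by rw [← h]; simp)
  hom_inv_id := hom₂_ext e.hom_inv_id
  inv_hom_id := hom₂_ext e.inv_hom_id

/-- The comma bicategory `B ↓ b`. Horizontal composition of 2-cells and the associativity and unit
constraints are those of `B`. -/
instance bicategory : Bicategory.{w, max w v} (CommaBicat b) where
  homCategory := homCategory
  whiskerLeft {_ _ Z} p q r η := Hom₂.mk (Hom.base p ◁ Hom₂.base η) (by
    have := Hom₂.w η
    simp [← this])
  whiskerRight {_ Y Z} p q η r := Hom₂.mk (Hom₂.base η ▷ Hom.base r) (by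
    have h := Hom₂.w η
    have e := whisker_exchange (Hom₂.base η) (Hom.cell r)
    simp only [comp_cell, ← h, Category.assoc]
    rw [← reassoc_of% e]
    simp)
  associator p q r := isoMk (α_ (Hom.base p) (Hom.base q) (Hom.base r)) (by
    simp)
  leftUnitor p := isoMk (λ_ (Hom.base p)) (by simp)
  rightUnitor p := isoMk (ρ_ (Hom.base p)) (by simp)
  whiskerLeft_id _ _ := hom₂_ext (Bicategory.whiskerLeft_id _ _)
  whiskerLeft_comp _ _ _ _ _ _ := hom₂_ext (Bicategory.whiskerLeft_comp _ _ _)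
  id_whiskerLeft _ := hom₂_ext (Bicategory.id_whiskerLeft _)
  comp_whiskerLeft _ _ _ _ _ := hom₂_ext (Bicategory.comp_whiskerLeft _ _ _)
  id_whiskerRight _ _ := hom₂_ext (Bicategory.id_whiskerRight _ _)
  comp_whiskerRight _ _ _ := hom₂_ext (Bicategory.comp_whiskerRight _ _ _)
  whiskerRight_id _ := hom₂_ext (Bicategory.whiskerRight_id _)
  whiskerRight_comp _ _ _ := hom₂_ext (Bicategory.whiskerRight_comp _ _ _)
  whisker_assoc _ _ _ _ _ := hom₂_ext (Bicategory.whisker_assoc _ _ _)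
  whisker_exchange _ _ := hom₂_ext (Bicategory.whisker_exchange _ _)
  pentagon _ _ _ _ := hom₂_ext (Bicategory.pentagon _ _ _ _)
  triangle _ _ := hom₂_ext (Bicategory.triangle _ _)

end CommaBicat

/-! ### The geometric nerve and the classifying space of a bicategory -/

/-- A geometric `n`-simplex of `C`: a lax functor `[n] → C`, where `[n] = {0 < ⋯ < n}` is
regarded as a bicategory with only identity 2-cells. -/
abbrev GeomSimplex (C : Type u) [Bicategory.{w, v} C] (n : ℕ) : Type (max u v w) :=
  LaxFunctor (LocallyDiscrete (Fin (n + 1))) C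

/-- A monotone map `σ : [m] → [n]`, on 1-cells of the locally discrete bicategories. -/
abbrev ordMap {m n : ℕ} (σ : Fin (m + 1) →o Fin (n + 1))
    {i j : LocallyDiscrete (Fin (m + 1))} (f : i ⟶ j) :
    (LocallyDiscrete.mk (σ i.as) : LocallyDiscrete (Fin (n + 1))) ⟶ LocallyDiscrete.mk (σ j.as) :=
  ⟨homOfLE (σ.monotone (leOfHom f.as))⟩

/-- A monotone map, on 2-cells of the locally discrete bicategories (which are all identities). -/
abbrev ordMap₂ {m n : ℕ} (σ : Fin (m + 1) →o Fin (n + 1))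
    {i j : LocallyDiscrete (Fin (m + 1))} {f g : i ⟶ j} (_ : f ⟶ g) : ordMap σ f ⟶ ordMap σ g :=
  ⟨⟨rfl⟩⟩

/-- The composite lax functor `z ∘ σ : [m] → C` of a geometric simplex `z : [n] → C` with a monotone
map `σ : [m] → [n]`; its 2-cells `1 ⟶ zσ(1)` and `zσ(g) ∘ zσ(f) ⟶ zσ(g ∘ f)` are those of `z`. -/
@[simps]
def GeomSimplex.precomp {C : Type u} [Bicategory.{w, v} C] {m n : ℕ} (z : GeomSimplex C n)
    (σ : Fin (m + 1) →o Fin (n + 1)) : GeomSimplex C m where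
  obj i := z.obj ⟨σ i.as⟩
  map f := z.map (ordMap σ f)
  map₂ η := z.map₂ (ordMap₂ σ η)
  map₂_id f := z.map₂_id (ordMap σ f)
  map₂_comp η θ := z.map₂_comp (ordMap₂ σ η) (ordMap₂ σ θ)
  mapId i := z.mapId ⟨σ i.as⟩
  mapComp f g := z.mapComp (ordMap σ f) (ordMap σ g)
  mapComp_naturality_left η g := z.mapComp_naturality_left (ordMap₂ σ η) (ordMap σ g)
  mapComp_naturality_right f _ _ η := z.mapComp_naturality_right (ordMap σ f) (ordMap₂ σ η)
  map₂_associator f g h := z.map₂_associator (ordMap σ f) (ordMap σ g) (ordMap σ h)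
  map₂_leftUnitor f := z.map₂_leftUnitor (ordMap σ f)
  map₂_rightUnitor f := z.map₂_rightUnitor (ordMap σ f)

/-- Lax functors with the same action on cells and the same constraints are equal. -/
lemma laxFunctor_ext {C : Type*} [Bicategory C] {D : Type*} [Bicategory D] {F G : LaxFunctor C D}
    (h : F.toPrelaxFunctor = G.toPrelaxFunctor) (h₁ : F.mapId ≍ G.mapId)
    (h₂ : @LaxFunctor.mapComp _ _ _ _ F ≍ @LaxFunctor.mapComp _ _ _ _ G) : F = G := by
  cases F; cases G; cases h; cases h₁; cases h₂; rfl

/-- `GeomSimplex.precomp` is the composite, as lax functors, of `z` with the (strict) functor given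
by `σ`. -/
lemma GeomSimplex.precomp_eq_comp {C : Type u} [Bicategory.{w, v} C] {m n : ℕ}
    (z : GeomSimplex C n) (σ : Fin (m + 1) →o Fin (n + 1)) :
    z.precomp σ = σ.monotone.functor.toPseudofunctor.toLax.comp z := by
  have h₁ : (z.precomp σ).mapId = (σ.monotone.functor.toPseudofunctor.toLax.comp z).mapId := by
    funext i
    exact ((congrArg _ (z.map₂_id (ordMap σ (𝟙 i)))).trans (Category.comp_id _)).symm
  have h₂ : @LaxFunctor.mapComp _ _ _ _ (z.precomp σ) =
      @LaxFunctor.mapComp _ _ _ _ (σ.monotone.functor.toPseudofunctor.toLax.comp z) := by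
    funext i j k f g
    exact ((congrArg _ (z.map₂_id (ordMap σ (f ≫ g)))).trans (Category.comp_id _)).symm
  exact laxFunctor_ext rfl (heq_of_eq h₁) (heq_of_eq h₂)

/-- The geometric nerve of a bicategory: the simplicial set `[n] ↦ {lax functors [n] → C}`, on which
monotone maps act by precomposition. -/
def geometricNerve (C : Type u) [Bicategory.{w, v} C] : SSet.{max u v w} where
  obj n := GeomSimplex C n.unop.len
  map σ := ↾fun z => GeomSimplex.precomp z σ.unop.toOrderHom
  map_id _ := rfl
  map_comp _ _ := rfl

/-- The classifying space of a bicategory: the geometric realization of its geometric nerve. -/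
noncomputable def classifyingSpace (C : Type u) [Bicategory.{w, v} C] : TopCat.{max u v w} :=
  SSet.toTop.obj (geometricNerve C)

/-! The object (1, b) is terminal in a lax sense: every (f, a) has the 1-cell f to it, and the
2-cell β of a 1-cell (β, u) fills the resulting triangle. These fillers form an oplax cocone, and
they point in the direction needed to extend the identity of B ↓ b to a lax functor on (B ↓ b) × [1]
that is constant over 1. Composing it with pairs (z, τ) of simplices of the nerve and of Δ[1] gives
a simplicial homotopy from the identity to a constant map (`GeomSimplex.cone`, `nerveContraction`).

A simplicial homotopy H realizes to a topological one (`toTop_map_homotopic`). Over each simplex, H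
is defined on the chains of [n] × [1]. These cover Δⁿ × Δ¹ (`exists_prism`) and the values agree on
overlaps: a point of the realization of a poset is determined by its barycentric coordinates
(`eq_of_map_eq`), and a distribution supported on a chain of [n] × [1] by its marginals
(`eq_of_marginals_eq`). The resulting maps Δⁿ → C(Δ¹, |Y|) glue over |X|. -/

/-! ### The oplax cocone to the apex and the cone it defines -/

namespace CommaBicat

variable {B : Type u} [Bicategory.{w, v} B] {b : B}

/-- The object `(1, b)` of `B ↓ b`. -/
def apex (b : B) : CommaBicat b := ⟨b, 𝟙 b⟩

/-- The 1-cell `(ρ⁻¹, f) : (f, a) ⟶ (1, b)` of `B ↓ b`. -/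
def toApex (X : CommaBicat b) : X ⟶ apex b := Hom.mk X.arr (ρ_ X.arr).inv

/-- The 1-cells to the apex form an oplax cocone, whose 2-cell at `(β, u)` is `β`. -/
def toApexCell {X Y : CommaBicat b} (p : X ⟶ Y) : toApex X ⟶ p ≫ toApex Y :=
  Hom₂.mk (Hom.cell p) (by simp [toApex, apex])

lemma toApexCell_naturality {X Y : CommaBicat b} {p q : X ⟶ Y} (η : p ⟶ q) :
    toApexCell p ≫ η ▷ toApex Y = toApexCell q :=
  hom₂_ext (Hom₂.w η)

/-- Both cocone axioms hold by definition: the 2-cells of identities and composites in B ↓ b are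
exactly these pastings. -/
lemma toApexCell_id (X : CommaBicat b) : toApexCell (𝟙 X) = (λ_ (toApex X)).inv := rfl

lemma toApexCell_comp {X Y Z : CommaBicat b} (p : X ⟶ Y) (q : Y ⟶ Z) :
    toApexCell (p ≫ q) = toApexCell p ≫ p ◁ toApexCell q ≫ (α_ p q (toApex Z)).inv := rfl

/-- The object part of the lax functor on `(B ↓ b) × [1]` which is the identity on `(B ↓ b) × {0}`
and constant at the apex on `(B ↓ b) × {1}`. The remaining data are `coneMap`, `coneMap₂`,
`coneMapId` and `coneMapComp`. -/
def coneObj (X : CommaBicat b) : Bool → CommaBicat b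
  | false => X
  | true => apex b

/-- The 1-cells of the cone. -/
def coneMap {X Y : CommaBicat b} (p : X ⟶ Y) :
    ∀ {i j : Bool}, i ≤ j → (coneObj X i ⟶ coneObj Y j)
  | false, false, _ => p
  | false, true, _ => p ≫ toApex Y
  | true, true, _ => 𝟙 (apex b)
  | true, false, h => absurd h (by decide)

/-- The 2-cells of the cone. -/
def coneMap₂ {X Y : CommaBicat b} {p q : X ⟶ Y} (η : p ⟶ q) :
    ∀ {i j : Bool} (h : i ≤ j), coneMap p h ⟶ coneMap q h
  | false, false, _ => η
  | false, true, _ => η ▷ toApex Y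
  | true, true, _ => 𝟙 (𝟙 (apex b))
  | true, false, h => absurd h (by decide)

/-- The unit constraints of the cone. -/
def coneMapId (X : CommaBicat b) : ∀ i : Bool, 𝟙 (coneObj X i) ⟶ coneMap (𝟙 X) (le_refl i)
  | false => 𝟙 (𝟙 X)
  | true => 𝟙 (𝟙 (apex b))

/-- The composition constraints of the cone; the one for `0 ≤ 1 ≤ 1` uses the 2-cells of the
oplax cocone. -/
def coneMapComp {X Y Z : CommaBicat b} (p : X ⟶ Y) (q : Y ⟶ Z) :
    ∀ {i j k : Bool} (h : i ≤ j) (h' : j ≤ k),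
      coneMap p h ≫ coneMap q h' ⟶ coneMap (p ≫ q) (h.trans h')
  | false, false, false, _, _ => 𝟙 (p ≫ q)
  | false, false, true, _, _ => (α_ p q (toApex Z)).inv
  | false, true, true, _, _ =>
      (ρ_ (p ≫ toApex Y)).hom ≫ p ◁ toApexCell q ≫ (α_ p q (toApex Z)).inv
  | true, true, true, _, _ => (λ_ (𝟙 (apex b))).hom
  | true, false, _, h, _ => absurd h (by decide)
  | _, true, false, _, h => absurd h (by decide)

lemma coneMap₂_id {X Y : CommaBicat b} (p : X ⟶ Y) {i j : Bool} (h : i ≤ j) :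
    coneMap₂ (𝟙 p) h = 𝟙 (coneMap p h) := by
  cases i <;> cases j
  · rfl
  · exact id_whiskerRight p (toApex Y)
  · exact absurd h (by decide)
  · rfl

lemma coneMap₂_comp {X Y : CommaBicat b} {p q r : X ⟶ Y} (η : p ⟶ q) (θ : q ⟶ r) {i j : Bool}
    (h : i ≤ j) : coneMap₂ (η ≫ θ) h = coneMap₂ η h ≫ coneMap₂ θ h := by
  cases i <;> cases j
  · rfl
  · exact comp_whiskerRight η θ (toApex Y)
  · exact absurd h (by decide)
  · exact (Category.comp_id _).symm

lemma coneMapComp_naturality_left {X Y Z : CommaBicat b} {p p' : X ⟶ Y} (η : p ⟶ p')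
    (q : Y ⟶ Z) {i j k : Bool} (h : i ≤ j) (h' : j ≤ k) :
    coneMapComp p q h h' ≫ coneMap₂ (η ▷ q) (h.trans h') =
      coneMap₂ η h ▷ coneMap q h' ≫ coneMapComp p' q h h' := by
  cases i <;> cases j <;> cases k <;> first
    | exact absurd h (by decide)
    | exact absurd h' (by decide)
    | skip
  · change 𝟙 (p ≫ q) ≫ η ▷ q = η ▷ q ≫ 𝟙 (p' ≫ q)
    simp
  · change (α_ p q (toApex Z)).inv ≫ η ▷ q ▷ toApex Z =
      η ▷ (q ≫ toApex Z) ≫ (α_ p' q (toApex Z)).inv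
    simp
  · change ((ρ_ (p ≫ toApex Y)).hom ≫ p ◁ toApexCell q ≫ (α_ p q (toApex Z)).inv) ≫
        η ▷ q ▷ toApex Z =
      η ▷ toApex Y ▷ 𝟙 (apex b) ≫
        (ρ_ (p' ≫ toApex Y)).hom ≫ p' ◁ toApexCell q ≫ (α_ p' q (toApex Z)).inv
    rw [rightUnitor_naturality_assoc, ← whisker_exchange_assoc]
    simp
  · change (λ_ (𝟙 (apex b))).hom ≫ 𝟙 (𝟙 (apex b)) =
      𝟙 (𝟙 (apex b)) ▷ 𝟙 (apex b) ≫ (λ_ (𝟙 (apex b))).hom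
    simp

/-- The case 0 ≤ 1 ≤ 1 is where the 2-cell condition of B ↓ b enters, as naturality of the cocone;
the others are coherence. -/
lemma coneMapComp_naturality_right {X Y Z : CommaBicat b} (p : X ⟶ Y) {q q' : Y ⟶ Z}
    (η : q ⟶ q') {i j k : Bool} (h : i ≤ j) (h' : j ≤ k) :
    coneMapComp p q h h' ≫ coneMap₂ (p ◁ η) (h.trans h') =
      coneMap p h ◁ coneMap₂ η h' ≫ coneMapComp p q' h h' := by
  cases i <;> cases j <;> cases k <;> first
    | exact absurd h (by decide)
    | exact absurd h' (by decide)
    | skip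
  · change 𝟙 (p ≫ q) ≫ p ◁ η = p ◁ η ≫ 𝟙 (p ≫ q')
    simp
  · change (α_ p q (toApex Z)).inv ≫ (p ◁ η) ▷ toApex Z =
      p ◁ η ▷ toApex Z ≫ (α_ p q' (toApex Z)).inv
    simp
  · change ((ρ_ (p ≫ toApex Y)).hom ≫ p ◁ toApexCell q ≫ (α_ p q (toApex Z)).inv) ≫
        (p ◁ η) ▷ toApex Z =
      (p ≫ toApex Y) ◁ 𝟙 (𝟙 (apex b)) ≫
        (ρ_ (p ≫ toApex Y)).hom ≫ p ◁ toApexCell q' ≫ (α_ p q' (toApex Z)).inv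
    rw [← toApexCell_naturality η]
    simp
  · change (λ_ (𝟙 (apex b))).hom ≫ 𝟙 (𝟙 (apex b)) =
      𝟙 (apex b) ◁ 𝟙 (𝟙 (apex b)) ≫ (λ_ (𝟙 (apex b))).hom
    simp

/-- Only five monotone sequences i ≤ j ≤ k ≤ l exist. For 0 ≤ 1 ≤ 1 ≤ 1 the composition axiom of the
cocone is needed; the others are coherence. -/
lemma coneMapComp_assoc {W X Y Z : CommaBicat b} (p : W ⟶ X) (q : X ⟶ Y) (r : Y ⟶ Z)
    {i j k l : Bool} (h : i ≤ j) (h' : j ≤ k) (h'' : k ≤ l) :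
    coneMapComp p q h h' ▷ coneMap r h'' ≫ coneMapComp (p ≫ q) r (h.trans h') h'' ≫
        coneMap₂ (α_ p q r).hom ((h.trans h').trans h'') =
      (α_ (coneMap p h) (coneMap q h') (coneMap r h'')).hom ≫
        coneMap p h ◁ coneMapComp q r h' h'' ≫ coneMapComp p (q ≫ r) h (h'.trans h'') := by
  cases i <;> cases j <;> cases k <;> cases l <;> first
    | exact absurd h (by decide)
    | exact absurd h' (by decide)
    | exact absurd h'' (by decide)
    | skip
  · change 𝟙 (p ≫ q) ▷ r ≫ 𝟙 ((p ≫ q) ≫ r) ≫ (α_ p q r).hom =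
      (α_ p q r).hom ≫ p ◁ 𝟙 (q ≫ r) ≫ 𝟙 (p ≫ q ≫ r)
    simp
  · change 𝟙 (p ≫ q) ▷ (r ≫ toApex Z) ≫ (α_ (p ≫ q) r (toApex Z)).inv ≫
        (α_ p q r).hom ▷ toApex Z =
      (α_ p q (r ≫ toApex Z)).hom ≫ p ◁ (α_ q r (toApex Z)).inv ≫
        (α_ p (q ≫ r) (toApex Z)).inv
    simp
  · change (α_ p q (toApex Y)).inv ▷ 𝟙 (apex b) ≫ ((ρ_ ((p ≫ q) ≫ toApex Y)).hom ≫
        (p ≫ q) ◁ toApexCell r ≫ (α_ (p ≫ q) r (toApex Z)).inv) ≫ (α_ p q r).hom ▷ toApex Z =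
      (α_ p (q ≫ toApex Y) (𝟙 (apex b))).hom ≫
        p ◁ ((ρ_ (q ≫ toApex Y)).hom ≫ q ◁ toApexCell r ≫ (α_ q r (toApex Z)).inv) ≫
          (α_ p (q ≫ r) (toApex Z)).inv
    simp
  · change ((ρ_ (p ≫ toApex X)).hom ≫ p ◁ toApexCell q ≫ (α_ p q (toApex Y)).inv) ▷ 𝟙 (apex b) ≫
        ((ρ_ ((p ≫ q) ≫ toApex Y)).hom ≫
          (p ≫ q) ◁ toApexCell r ≫ (α_ (p ≫ q) r (toApex Z)).inv) ≫ (α_ p q r).hom ▷ toApex Z =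
      (α_ (p ≫ toApex X) (𝟙 (apex b)) (𝟙 (apex b))).hom ≫
        (p ≫ toApex X) ◁ (λ_ (𝟙 (apex b))).hom ≫
          (ρ_ (p ≫ toApex X)).hom ≫ p ◁ toApexCell (q ≫ r) ≫ (α_ p (q ≫ r) (toApex Z)).inv
    simp [toApexCell_comp]
  · change (λ_ (𝟙 (apex b))).hom ▷ 𝟙 (apex b) ≫ (λ_ (𝟙 (apex b))).hom ≫ 𝟙 (𝟙 (apex b)) =
      (α_ (𝟙 (apex b)) (𝟙 (apex b)) (𝟙 (apex b))).hom ≫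
        𝟙 (apex b) ◁ (λ_ (𝟙 (apex b))).hom ≫ (λ_ (𝟙 (apex b))).hom
    simp

lemma coneMap_leftUnitor {X Y : CommaBicat b} (p : X ⟶ Y) {i j : Bool} (h : i ≤ j) :
    coneMap₂ (λ_ p).inv h = (λ_ (coneMap p h)).inv ≫ coneMapId X i ▷ coneMap p h ≫
      coneMapComp (𝟙 X) p le_rfl h := by
  cases i <;> cases j <;> first
    | exact absurd h (by decide)
    | skip
  · change (λ_ p).inv = (λ_ p).inv ≫ 𝟙 (𝟙 X) ▷ p ≫ 𝟙 (𝟙 X ≫ p)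
    simp
  · change (λ_ p).inv ▷ toApex Y =
      (λ_ (p ≫ toApex Y)).inv ≫ 𝟙 (𝟙 X) ▷ (p ≫ toApex Y) ≫ (α_ (𝟙 X) p (toApex Y)).inv
    simp
  · change 𝟙 (𝟙 (apex b)) =
      (λ_ (𝟙 (apex b))).inv ≫ 𝟙 (𝟙 (apex b)) ▷ 𝟙 (apex b) ≫ (λ_ (𝟙 (apex b))).hom
    simp

/-- The case 0 ≤ 1 is the identity axiom of the cocone. -/
lemma coneMap_rightUnitor {X Y : CommaBicat b} (p : X ⟶ Y) {i j : Bool} (h : i ≤ j) :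
    coneMap₂ (ρ_ p).inv h = (ρ_ (coneMap p h)).inv ≫ coneMap p h ◁ coneMapId Y j ≫
      coneMapComp p (𝟙 Y) h le_rfl := by
  cases i <;> cases j <;> first
    | exact absurd h (by decide)
    | skip
  · change (ρ_ p).inv = (ρ_ p).inv ≫ p ◁ 𝟙 (𝟙 Y) ≫ 𝟙 (p ≫ 𝟙 Y)
    simp
  · change (ρ_ p).inv ▷ toApex Y =
      (ρ_ (p ≫ toApex Y)).inv ≫ (p ≫ toApex Y) ◁ 𝟙 (𝟙 (apex b)) ≫
        (ρ_ (p ≫ toApex Y)).hom ≫ p ◁ toApexCell (𝟙 Y) ≫ (α_ p (𝟙 Y) (toApex Y)).inv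
    simp [toApexCell_id]
  · change 𝟙 (𝟙 (apex b)) =
      (ρ_ (𝟙 (apex b))).inv ≫ 𝟙 (apex b) ◁ 𝟙 (𝟙 (apex b)) ≫ (λ_ (𝟙 (apex b))).hom
    simp [unitors_equal]

end CommaBicat

/-! ### Cones on geometric simplices -/

/-- The geometric simplex of `B ↓ b` obtained from `z` by moving to the apex the vertices on which
`τ` is `true`. -/
def GeomSimplex.cone {B : Type u} [Bicategory.{w, v} B] {b : B} {n : ℕ}
    (z : GeomSimplex (CommaBicat b) n) (τ : Fin (n + 1) →o Bool) :
    GeomSimplex (CommaBicat b) n where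
  obj i := CommaBicat.coneObj (z.obj i) (τ i.as)
  map f := CommaBicat.coneMap (z.map f) (τ.monotone (leOfHom f.as))
  map₂ {_ _ f g} η := CommaBicat.coneMap₂ (z.map₂ η) (τ.monotone (leOfHom f.as))
  map₂_id f := (congrArg (CommaBicat.coneMap₂ · _) (z.map₂_id f)).trans
    (CommaBicat.coneMap₂_id _ _)
  map₂_comp η θ := (congrArg (CommaBicat.coneMap₂ · _) (z.map₂_comp η θ)).trans
    (CommaBicat.coneMap₂_comp _ _ _)
  -- The constraints are those of a composite of lax functors: first the cone's own, then the image
  -- of those of `z`.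
  mapId i := CommaBicat.coneMapId (z.obj i) (τ i.as) ≫ CommaBicat.coneMap₂ (z.mapId i) le_rfl
  mapComp f g := CommaBicat.coneMapComp (z.map f) (z.map g) (τ.monotone (leOfHom f.as))
    (τ.monotone (leOfHom g.as)) ≫ CommaBicat.coneMap₂ (z.mapComp f g) _
  mapComp_naturality_left η g := by
    rw [Category.assoc]
    erw [← CommaBicat.coneMap₂_comp]
    rw [z.mapComp_naturality_left, CommaBicat.coneMap₂_comp]
    erw [reassoc_of% @CommaBicat.coneMapComp_naturality_left]
  mapComp_naturality_right f _ _ η := by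
    rw [Category.assoc]
    erw [← CommaBicat.coneMap₂_comp]
    rw [z.mapComp_naturality_right, CommaBicat.coneMap₂_comp]
    erw [reassoc_of% @CommaBicat.coneMapComp_naturality_right]
  map₂_associator f g h := by
    have H := z.map₂_associator f g h
    -- Naturality moves the constraints of `z` past those of the cone; the associativity axioms of
    -- `z` and of the cone then apply separately.
    simp only [comp_whiskerRight, Bicategory.whiskerLeft_comp, Category.assoc]
    rw [← reassoc_of% @CommaBicat.coneMapComp_naturality_left,
      ← reassoc_of% @CommaBicat.coneMapComp_naturality_right]
    erw [← CommaBicat.coneMap₂_comp, ← CommaBicat.coneMap₂_comp]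
    rw [H, CommaBicat.coneMap₂_comp, reassoc_of% @CommaBicat.coneMapComp_assoc]
    erw [← CommaBicat.coneMap₂_comp]
  map₂_leftUnitor f := by
    rw [z.map₂_leftUnitor, CommaBicat.coneMap₂_comp, CommaBicat.coneMap₂_comp,
      CommaBicat.coneMap_leftUnitor]
    simp only [comp_whiskerRight, Category.assoc]
    rw [← reassoc_of% @CommaBicat.coneMapComp_naturality_left]
  map₂_rightUnitor f := by
    rw [z.map₂_rightUnitor, CommaBicat.coneMap₂_comp, CommaBicat.coneMap₂_comp,
      CommaBicat.coneMap_rightUnitor]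
    simp only [Bicategory.whiskerLeft_comp, Category.assoc]
    rw [← reassoc_of% @CommaBicat.coneMapComp_naturality_right]

lemma GeomSimplex.cone_false {B : Type u} [Bicategory.{w, v} B] {b : B} {n : ℕ}
    (z : GeomSimplex (CommaBicat b) n) : z.cone (OrderHom.const _ false) = z := by
  refine laxFunctor_ext rfl (heq_of_eq ?_) (heq_of_eq ?_)
  · funext i
    exact Category.id_comp (z.mapId i)
  · funext i j k f g
    exact Category.id_comp (z.mapComp f g)

/-! ### Barycentric coordinates, chains in posets and prisms -/

namespace stdSimplex

lemma map_apply_eq_sum {X Y : Type*} [Fintype X] [Fintype Y] [DecidableEq Y] (f : X → Y)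
    (s : stdSimplex ℝ X) (y : Y) : map f s y = ∑ x, if f x = y then s x else 0 := by
  rw [map_coe, FunOnFinite.linearMap_apply_apply, Finset.sum_filter]

lemma le_map_apply {X Y : Type*} [Fintype X] [Fintype Y] (f : X → Y)
    (s : stdSimplex ℝ X) (x : X) : s x ≤ map f s (f x) := by
  classical
  rw [map_apply_eq_sum]
  refine le_trans (by simp) (Finset.single_le_sum (f := fun x' ↦ if f x' = f x then s x' else 0)
    (fun i _ ↦ ?_) (Finset.mem_univ x))
  split_ifs <;> simp

lemma exists_of_map_pos {X Y : Type*} [Fintype X] [Fintype Y] {f : X → Y}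
    {s : stdSimplex ℝ X} {y : Y} (h : 0 < map f s y) : ∃ x, f x = y ∧ 0 < s x := by
  classical
  rw [map_apply_eq_sum] at h
  obtain ⟨x, -, hx⟩ := Finset.exists_lt_of_sum_lt (f := fun _ ↦ (0 : ℝ)) (by simpa using h)
  by_cases hxy : f x = y
  · exact ⟨x, hxy, by simpa [hxy] using hx⟩
  · simp [hxy] at hx

lemma map_apply_of_injective {X Y : Type*} [Fintype X] [Fintype Y] {f : X → Y}
    (hf : Function.Injective f) (s : stdSimplex ℝ X) (x : X) : map f s (f x) = s x := by
  classical
  simp [map_apply_eq_sum, hf.eq_iff]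

/-- A point of the `(m + 1)`-simplex with a vanishing coordinate lies on a face. -/
lemma exists_map_succAbove_eq {m : ℕ} (s : stdSimplex ℝ (Fin (m + 2))) (j : Fin (m + 2))
    (hj : s j = 0) : ∃ s' : stdSimplex ℝ (Fin (m + 1)), map j.succAbove s' = s := by
  refine ⟨⟨fun i ↦ s (j.succAbove i), fun i ↦ s.2.1 _, ?_⟩, ?_⟩
  · have := sum_eq_one s
    rwa [Fin.sum_univ_succAbove _ j, hj, zero_add] at this
  · ext i
    cases i using Fin.succAboveCases j with
    | x =>
      rw [map_apply_eq_sum]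
      refine Eq.trans ?_ hj.symm
      exact Finset.sum_eq_zero fun i _ ↦ by simp
    | p i => exact map_apply_of_injective Fin.succAbove_right_injective _ i

section Chain

-- A pair (g, s) represents a point of the realization of the nerve of `P`, and `hev` is the gluing
-- relation; so `ev` stands for an arbitrary function on that realization.
variable {P α : Type*} [PartialOrder P] [Fintype P]
  (ev : ∀ m : ℕ, (Fin (m + 1) →o P) → stdSimplex ℝ (Fin (m + 1)) → α)
  (hev : ∀ (m m' : ℕ) (θ : Fin (m + 1) →o Fin (m' + 1)) (g : Fin (m' + 1) →o P)
    (s : stdSimplex ℝ (Fin (m + 1))), ev m (g.comp θ) s = ev m' g (map θ s))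

include hev in
/-- In the realization of a partially ordered set, every point has a nondegenerate
representative. -/
lemma exists_strictMono_representative (m : ℕ) (g : Fin (m + 1) →o P)
    (s : stdSimplex ℝ (Fin (m + 1))) :
    ∃ (m' : ℕ) (g' : Fin (m' + 1) →o P) (s' : stdSimplex ℝ (Fin (m' + 1))), StrictMono g' ∧
      (∀ i, 0 < s' i) ∧ map g' s' = map g s ∧ ev m' g' s' = ev m g s := by
  induction m with
  | zero => exact ⟨0, g, s, Subsingleton.strictMono (α := Fin 1) _, fun i ↦ by
      exact one_pos.trans_eq (eq_one_of_unique (X := Fin 1) s i).symm, rfl, rfl⟩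
  | succ m ih =>
    by_cases h : ∀ i, 0 < s i
    · by_cases hg : StrictMono g
      · exact ⟨_, g, s, hg, h, rfl, rfl⟩
      · rw [Fin.strictMono_iff_lt_succ] at hg
        push Not at hg
        obtain ⟨j, hj⟩ := hg
        have hj : g j.castSucc = g j.succ :=
          (g.monotone j.castSucc_lt_succ.le).eq_of_not_lt hj
        -- A repeated value makes g degenerate: it factors through the map merging j and j + 1.
        have hgj : g = (g.comp j.castSucc.succAboveOrderEmb.toOrderHom).comp
            (Fin.predAboveOrderHom j) := by
          ext i
          by_cases hi : i = j.castSucc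
          · subst hi
            simpa using hj
          · simp [hi]
        obtain ⟨m', g', s', h₁, h₂, h₃, h₄⟩ := ih
          (g.comp j.castSucc.succAboveOrderEmb.toOrderHom) (map (Fin.predAboveOrderHom j) s)
        refine ⟨m', g', s', h₁, h₂, ?_, ?_⟩
        · rw [h₃, map_comp_apply]
          conv_rhs => rw [hgj]
          rfl
        · rw [h₄, ← hev, ← hgj]
    · push Not at h
      obtain ⟨j, hj⟩ := h
      obtain ⟨s, rfl⟩ := exists_map_succAbove_eq s j (le_antisymm hj (zero_le s j))
      obtain ⟨m', g', s', h₁, h₂, h₃, h₄⟩ := ih (g.comp j.succAboveOrderEmb.toOrderHom) s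
      refine ⟨m', g', s', h₁, h₂, ?_, ?_⟩
      · rw [h₃, map_comp_apply]
        rfl
      · rw [h₄, hev]
        rfl

include hev in
/-- A point of the realization of a partially ordered set is determined by its barycentric
coordinates. -/
lemma eq_of_map_eq {m m' : ℕ} (g : Fin (m + 1) →o P) (s : stdSimplex ℝ (Fin (m + 1)))
    (g' : Fin (m' + 1) →o P) (s' : stdSimplex ℝ (Fin (m' + 1))) (h : map g s = map g' s') :
    ev m g s = ev m' g' s' := by
  obtain ⟨k, f, t, hf, ht, h₁, h₂⟩ := exists_strictMono_representative ev hev m g s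
  obtain ⟨k', f', t', hf', ht', h₁', h₂'⟩ := exists_strictMono_representative ev hev m' g' s'
  rw [← h₂, ← h₂']
  rw [← h₁, ← h₁'] at h
  -- The support of the coordinates recovers the range of a nondegenerate chain, hence the chain
  -- itself; injectivity then recovers the weights.
  have key {k : ℕ} (f : Fin (k + 1) →o P) (t : stdSimplex ℝ (Fin (k + 1))) (ht : ∀ i, 0 < t i) :
      Set.range f = {p | 0 < map f t p} := by
    ext p
    constructor
    · rintro ⟨i, rfl⟩
      exact (ht i).trans_le (le_map_apply f t i)
    · intro hp
      obtain ⟨x, hx, -⟩ := exists_of_map_pos hp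
      exact ⟨x, hx⟩
  have hr : Set.range f = Set.range f' := by rw [key f t ht, key f' t' ht', h]
  obtain rfl : k = k' := by
    have h₁ := Nat.card_range_of_injective hf.injective
    have h₂ := Nat.card_range_of_injective hf'.injective
    rw [hr, h₂] at h₁
    simpa using h₁.symm
  obtain rfl : f = f' := DFunLike.coe_injective ((hf.range_inj hf').1 hr)
  obtain rfl : t = t' := by
    ext i
    rw [← map_apply_of_injective hf.injective, h, map_apply_of_injective hf.injective]
  rfl

end Chain

section Prism

variable {n : ℕ}

lemma map_fst_apply (μ : stdSimplex ℝ (Fin (n + 1) × Fin 2)) (i : Fin (n + 1)) :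
    map Prod.fst μ i = μ (i, 0) + μ (i, 1) := by
  simp [map_apply_eq_sum, Fintype.sum_prod_type, Finset.sum_add_distrib]

lemma map_snd_apply (μ : stdSimplex ℝ (Fin (n + 1) × Fin 2)) (e : Fin 2) :
    map Prod.snd μ e = ∑ i, μ (i, e) := by
  simp [map_apply_eq_sum, Fintype.sum_prod_type]

/-- Among the points of the simplex on `[n] × [1]` with given marginals, those supported on a chain
have the largest first differing coordinate. -/
lemma le_of_marginals_eq {μ μ' : stdSimplex ℝ (Fin (n + 1) × Fin 2)}
    (hμ : ∀ i i', 0 < μ (i, 1) → 0 < μ (i', 0) → i' ≤ i)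
    (h₁ : map Prod.fst μ = map Prod.fst μ') (h₂ : map Prod.snd μ = map Prod.snd μ')
    (i : Fin (n + 1)) (hi : ∀ i' < i, μ (i', 0) = μ' (i', 0)) : μ' (i, 0) ≤ μ (i, 0) := by
  by_contra! h
  have e₁ := DFunLike.congr_fun h₁ i
  rw [map_fst_apply, map_fst_apply] at e₁
  have e₂ := DFunLike.congr_fun h₂ 0
  rw [map_snd_apply, map_snd_apply] at e₂
  have pos : 0 < μ (i, 1) := by linarith [zero_le μ' (i, 1)]
  -- As μ(i, 1) > 0, row 0 of μ vanishes beyond i, so its total mass would be strictly below that of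
  -- μ'.
  refine (Finset.sum_lt_sum (fun i' _ ↦ ?_) ⟨i, Finset.mem_univ i, h⟩).ne e₂
  rcases lt_trichotomy i' i with hlt | rfl | hlt
  · exact (hi i' hlt).le
  · exact h.le
  · have : ¬ 0 < μ (i', 0) := fun h' ↦ (hμ i i' pos h').not_gt hlt
    exact (not_lt.1 this).trans (zero_le μ' _)

lemma eq_of_marginals_eq {μ μ' : stdSimplex ℝ (Fin (n + 1) × Fin 2)}
    (hμ : ∀ i i', 0 < μ (i, 1) → 0 < μ (i', 0) → i' ≤ i)
    (hμ' : ∀ i i', 0 < μ' (i, 1) → 0 < μ' (i', 0) → i' ≤ i)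
    (h₁ : map Prod.fst μ = map Prod.fst μ') (h₂ : map Prod.snd μ = map Prod.snd μ') : μ = μ' := by
  have h₀ (i : Fin (n + 1)) : μ (i, 0) = μ' (i, 0) := by
    induction i using WellFoundedLT.induction with
    | ind i ih => exact le_antisymm (le_of_marginals_eq hμ' h₁.symm h₂.symm i
        fun i' hi' ↦ (ih i' hi').symm) (le_of_marginals_eq hμ h₁ h₂ i ih)
  ext ⟨i, e⟩
  have e₁ := DFunLike.congr_fun h₁ i
  rw [map_fst_apply, map_fst_apply, h₀] at e₁
  fin_cases e
  · exact h₀ i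
  · exact add_left_cancel e₁

lemma le_of_map_pos {m : ℕ} (g : Fin (m + 1) →o Fin (n + 1) × Fin 2)
    (s : stdSimplex ℝ (Fin (m + 1))) (i i' : Fin (n + 1)) (h : 0 < map g s (i, 1))
    (h' : 0 < map g s (i', 0)) : i' ≤ i := by
  obtain ⟨j, hj, -⟩ := exists_of_map_pos h
  obtain ⟨j', hj', -⟩ := exists_of_map_pos h'
  rcases le_total j j' with hl | hl
  · have := g.monotone hl
    rw [hj, hj'] at this
    exact absurd (show (1 : Fin 2) ≤ 0 from this.2) (by decide)
  · have := g.monotone hl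
    rw [hj, hj'] at this
    exact this.1

/-- Here k is the vertex where the partial sums of t reach c, and a is the part of t k below the
cut. It locates the maximal chain of the prism containing a given point. -/
lemma exists_partial_sum (n : ℕ) (t : Fin (n + 1) → ℝ) (ht : ∀ i, 0 ≤ t i) (c : ℝ) (hc : 0 ≤ c)
    (hc' : c ≤ ∑ i, t i) :
    ∃ (k : Fin (n + 1)) (a : ℝ), 0 ≤ a ∧ a ≤ t k ∧ a + ∑ i, (if i < k then t i else 0) = c := by
  induction n generalizing c with
  | zero => exact ⟨0, c, hc, by simpa using hc', by simp⟩
  | succ n ih =>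
    by_cases h : c ≤ t 0
    · exact ⟨0, c, hc, h, by simp⟩
    · rw [Fin.sum_univ_succ] at hc'
      obtain ⟨k, a, h₁, h₂, h₃⟩ := ih (fun i ↦ t i.succ) (fun i ↦ ht _) (c - t 0)
        (by linarith) (by linarith)
      refine ⟨k.succ, a, h₁, h₂, ?_⟩
      rw [Fin.sum_univ_succ]
      simp only [Fin.succ_lt_succ_iff, Fin.succ_pos, if_true]
      linarith

/-- The chains of length `n + 2` in `[n] × [1]` cover the product of the simplices. -/
lemma exists_prism (t : stdSimplex ℝ (Fin (n + 1))) (c : stdSimplex ℝ (Fin 2)) :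
    ∃ (g : Fin (n + 2) →o Fin (n + 1) × Fin 2) (s : stdSimplex ℝ (Fin (n + 2))),
      map (fun j ↦ (g j).1) s = t ∧ map (fun j ↦ (g j).2) s = c := by
  obtain ⟨k, a, ha, hak, hs⟩ := exists_partial_sum n t (zero_le t) (c 0) (zero_le c 0) (by simp)
  -- The maximal chain (0,0), …, (k,0), (k,1), …, (n,1), which changes row at k.
  let g : Fin (n + 2) →o Fin (n + 1) × Fin 2 :=
    { toFun j := (k.predAbove j, if j ≤ k.castSucc then 0 else 1)
      monotone' i j h := by
        refine ⟨Fin.predAbove_right_monotone k h, ?_⟩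
        dsimp
        split_ifs <;> grind }
  have hg₂ (j) : (g j).2 = 0 ↔ j ≤ k.castSucc := by
    change (if j ≤ k.castSucc then (0 : Fin 2) else 1) = 0 ↔ _
    split_ifs <;> simp [*]
  -- The mass t k is split as a on (k,0) and t k - a on (k,1): `k.castSucc.succAbove` sends k to
  -- `k.succ`, the second copy.
  obtain ⟨s, hs₁, hs₂⟩ : ∃ s : Fin (n + 2) → ℝ, s k.castSucc = a ∧
      ∀ i, s (k.castSucc.succAbove i) = if i = k then t k - a else t i :=
    ⟨k.castSucc.insertNth a fun i ↦ if i = k then t k - a else t i,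
      Fin.insertNth_apply_same _ _ _, fun i ↦ Fin.insertNth_apply_succAbove _ _ _ i⟩
  have hsum (f : Fin (n + 2) → Prop) [DecidablePred f] : ∑ j, (if f j then s j else 0) =
      (if f k.castSucc then a else 0) + ∑ i, if f (k.castSucc.succAbove i) then
        (if i = k then t k - a else t i) else 0 := by
    simp only [Fin.sum_univ_succAbove _ k.castSucc, hs₁, hs₂]
  let s' : stdSimplex ℝ (Fin (n + 2)) := ⟨s, fun j ↦ by
    cases j using Fin.succAboveCases k.castSucc with
    | x => rwa [hs₁]
    | p i =>
      rw [hs₂]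
      split_ifs
      · linarith
      · exact zero_le t i, by
    rw [Fin.sum_univ_succAbove _ k.castSucc, hs₁, ← sum_eq_one t,
      Finset.sum_congr rfl fun i _ ↦ (show s (k.castSucc.succAbove i) =
        t i - if i = k then a else 0 by rw [hs₂]; split_ifs with h <;> simp [h]),
      Finset.sum_sub_distrib]
    simp⟩
  have e₀ : map (fun j ↦ (g j).2) s' 0 = c 0 := by
    rw [map_apply_eq_sum]
    refine (hsum _).trans ?_
    rw [← hs, if_pos ((hg₂ _).2 le_rfl)]
    congr 1
    refine Finset.sum_congr rfl fun i _ ↦ ?_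
    rcases lt_or_ge i k with h | h
    · have : i.castSucc < k.castSucc := h
      rw [if_pos ((hg₂ _).2 (by rw [Fin.succAbove_of_castSucc_lt _ _ this]; exact this.le)),
        if_neg h.ne, if_pos h]
    · have h' : k.castSucc ≤ i.castSucc := h
      rw [if_neg (mt (hg₂ _).1 (by
        rw [Fin.succAbove_of_le_castSucc _ _ h', not_le]
        exact h'.trans_lt i.castSucc_lt_succ)), if_neg h.not_gt]
  refine ⟨g, s', ?_, ?_⟩
  · ext i
    rw [map_apply_eq_sum]
    refine (hsum _).trans ?_
    have hg₁ (i) : (g (k.castSucc.succAbove i)).1 = i := Fin.predAbove_succAbove k i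
    have hg₁' : (g k.castSucc).1 = k := Fin.predAbove_castSucc_self k
    simp only [hg₁, hg₁', Finset.sum_ite_eq', Finset.mem_univ, if_true]
    by_cases h : k = i
    · subst h; simp
    · simp [h, Ne.symm h]
  · ext e
    fin_cases e
    · exact e₀
    · have h₁ := add_eq_one (map (fun j ↦ (g j).2) s')
      have h₂ := add_eq_one c
      change map (fun j ↦ (g j).2) s' 1 = c 1
      linarith

end Prism

end stdSimplex

lemma stdSimplex.map_const_apply {X Y : Type*} [Fintype X] [Fintype Y] [DecidableEq Y] (y : Y)
    (s : stdSimplex ℝ X) : map (fun _ ↦ y) s = vertex y := by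
  ext y'
  simp [map_apply_eq_sum, Pi.single_apply, eq_comm]

lemma stdSimplexHomeomorphUnitInterval_symm_zero :
    stdSimplexHomeomorphUnitInterval.symm 0 = stdSimplex.vertex 0 :=
  stdSimplexHomeomorphUnitInterval.symm_apply_apply (stdSimplex.vertex 0)

lemma stdSimplexHomeomorphUnitInterval_symm_one :
    stdSimplexHomeomorphUnitInterval.symm 1 = stdSimplex.vertex 1 :=
  stdSimplexHomeomorphUnitInterval.symm_apply_apply (stdSimplex.vertex 1)

/-- A finite family of continuous maps from a compact space, jointly surjective onto a Hausdorff
space, is a quotient map. -/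
lemma ContinuousMap.exists_of_jointly_surjective {ι K Z W : Type*} [Finite ι] [TopologicalSpace K]
    [CompactSpace K] [TopologicalSpace Z] [T2Space Z] [TopologicalSpace W] (f : ι → C(K, Z))
    (hf : ∀ z, ∃ i k, f i k = z) (g : ι → C(K, W))
    (hfg : ∀ i j k l, f i k = f j l → g i k = g j l) :
    ∃ ψ : C(Z, W), ∀ i k, ψ (f i k) = g i k := by
  let π : C((_ : ι) × K, Z) := .sigma f
  have hq : Topology.IsQuotientMap π := π.continuous.isClosedMap.isQuotientMap π.continuous
    fun z ↦ by
      obtain ⟨i, k, h⟩ := hf z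
      exact ⟨⟨i, k⟩, h⟩
  let φ : C((_ : ι) × K, W) := .sigma g
  have hφ : Function.FactorsThrough φ π := fun a b h ↦ hfg _ _ _ _ h
  exact ⟨hq.lift φ hφ, fun i k ↦ DFunLike.congr_fun (hq.lift_comp φ hφ) ⟨i, k⟩⟩

/-! ### Realization of simplicial homotopies -/

namespace SSet

open Opposite MonoidalCategory Simplicial

/-- The point of the realization of `Y` given by an `n`-simplex and barycentric coordinates. -/
noncomputable def realizationPoint {Y : SSet.{u}} {n : ℕ} (y : Y _⦋n⦌) :
    C(_root_.stdSimplex ℝ (Fin (n + 1)), SSet.toTop.obj Y) :=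
  TopCat.toSSetObjEquiv _ _ ((sSetTopAdj.unit.app Y).app (op ⦋n⦌) y)

lemma realizationPoint_map {Y : SSet.{u}} {m n : ℕ} (θ : ⦋m⦌ ⟶ ⦋n⦌) (y : Y _⦋n⦌)
    (s : _root_.stdSimplex ℝ (Fin (m + 1))) :
    realizationPoint (Y.map θ.op y) s =
      realizationPoint y (stdSimplex.map θ.toOrderHom s) := by
  have := NatTrans.naturality_apply (sSetTopAdj.unit.app Y) θ.op y
  exact DFunLike.congr_fun (congrArg (TopCat.toSSetObjEquiv _ _) this) s

lemma toTop_map_realizationPoint {X Y : SSet.{u}} (f : X ⟶ Y) {n : ℕ} (x : X _⦋n⦌)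
    (s : _root_.stdSimplex ℝ (Fin (n + 1))) :
    toTop.map f (realizationPoint x s) = realizationPoint (f.app _ x) s := by
  have := congr_arg (fun φ ↦ φ.app (op ⦋n⦌) x) (sSetTopAdj.unit.naturality f)
  exact (DFunLike.congr_fun (congrArg (TopCat.toSSetObjEquiv _ _) this) s).symm

/-- Maps out of the realization are determined by their values on the simplices. -/
lemma toTop_hom_ext {X : SSet.{u}} {Z : TopCat.{u}} {f g : toTop.obj X ⟶ Z}
    (h : ∀ (n : ℕ) (x : X _⦋n⦌) (s : _root_.stdSimplex ℝ (Fin (n + 1))),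
      f (realizationPoint x s) = g (realizationPoint x s)) : f = g := by
  apply (sSetTopAdj.homEquiv _ _).injective
  ext ⟨⟨n⟩⟩ x
  apply (TopCat.toSSetObjEquiv _ _).injective
  ext s
  rw [Adjunction.homEquiv_unit, Adjunction.homEquiv_unit]
  exact h n x s

/-- A compatible family is a simplicial map from X to the singular set of Z; f is its transpose. -/
lemma exists_toTop_hom {X : SSet.{u}} {Z : TopCat.{u}}
    (φ : ∀ (n : ℕ), X _⦋n⦌ → C(_root_.stdSimplex ℝ (Fin (n + 1)), Z))
    (hφ : ∀ (m n : ℕ) (θ : ⦋m⦌ ⟶ ⦋n⦌) (x : X _⦋n⦌) (s : _root_.stdSimplex ℝ (Fin (m + 1))),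
      φ m (X.map θ.op x) s = φ n x (stdSimplex.map θ.toOrderHom s)) :
    ∃ f : toTop.obj X ⟶ Z, ∀ (n : ℕ) (x : X _⦋n⦌) (s : _root_.stdSimplex ℝ (Fin (n + 1))),
      f (realizationPoint x s) = φ n x s := by
  let F : X ⟶ TopCat.toSSet.obj Z :=
    { app n := ↾fun x ↦ (TopCat.toSSetObjEquiv Z n).symm (φ n.unop.len x)
      naturality := by
        rintro ⟨⟨n⟩⟩ ⟨⟨m⟩⟩ ⟨θ⟩
        ext x
        apply (TopCat.toSSetObjEquiv _ _).injective
        ext s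
        exact hφ m n θ x s }
  refine ⟨(sSetTopAdj.homEquiv _ _).symm F, fun n x s ↦ ?_⟩
  have h := (sSetTopAdj.homEquiv _ _).apply_symm_apply F
  rw [Adjunction.homEquiv_unit] at h
  have := congr_arg (fun φ ↦ φ.app (op ⦋n⦌) x) h
  exact DFunLike.congr_fun (congrArg (TopCat.toSSetObjEquiv _ _) this) s

section Homotopy

variable {X Y : SSet.{u}} (H : X ⊗ Δ[1] ⟶ Y)

/-- The simplex of `Y` which is the value of `H` at the restriction of the product of a simplex of
`X` with the interval along a chain. -/
def prismSimplex {n : ℕ} (x : X _⦋n⦌) {m : ℕ} (g : Fin (m + 1) →o Fin (n + 1) × Fin 2) : Y _⦋m⦌ :=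
  H.app (op ⦋m⦌) ((X.map (SimplexCategory.mkHom (OrderHom.fst.comp g)).op x,
    stdSimplex.objMk (n := ⦋1⦌) (OrderHom.snd.comp g)) : X _⦋m⦌ × Δ[1] _⦋m⦌)

lemma prismSimplex_comp {n : ℕ} (x : X _⦋n⦌) {m m' : ℕ} (θ : Fin (m + 1) →o Fin (m' + 1))
    (g : Fin (m' + 1) →o Fin (n + 1) × Fin 2) :
    prismSimplex H x (g.comp θ) =
      Y.map (SimplexCategory.mkHom θ).op (prismSimplex H x g) := by
  refine Eq.trans ?_ (NatTrans.naturality_apply H (SimplexCategory.mkHom θ).op _)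
  refine congrArg (H.app (op ⦋m⦌)) (Prod.ext ?_ rfl)
  exact ConcreteCategory.congr_hom (X.map_comp (SimplexCategory.mkHom (OrderHom.fst.comp g)).op
    (SimplexCategory.mkHom θ).op) x

lemma prismSimplex_map {n n' : ℕ} (θ : ⦋n⦌ ⟶ ⦋n'⦌) (x : X _⦋n'⦌) {m : ℕ}
    (g : Fin (m + 1) →o Fin (n + 1) × Fin 2) :
    prismSimplex H (X.map θ.op x) g =
      prismSimplex H x ((OrderHom.prodMap θ.toOrderHom OrderHom.id).comp g) := by
  refine congrArg (H.app (op ⦋m⦌)) (Prod.ext ?_ rfl)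
  exact (ConcreteCategory.congr_hom (X.map_comp θ.op
    (SimplexCategory.mkHom (OrderHom.fst.comp g)).op) x).symm

/-- Equal marginals force equal distributions on [n] × [1], both being supported on chains, and
these determine the point. -/
lemma realizationPoint_prismSimplex_eq {n : ℕ} (x : X _⦋n⦌) {m m' : ℕ}
    (g : Fin (m + 1) →o Fin (n + 1) × Fin 2) (s : _root_.stdSimplex ℝ (Fin (m + 1)))
    (g' : Fin (m' + 1) →o Fin (n + 1) × Fin 2) (s' : _root_.stdSimplex ℝ (Fin (m' + 1)))
    (h₁ : stdSimplex.map (fun j ↦ (g j).1) s = stdSimplex.map (fun j ↦ (g' j).1) s')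
    (h₂ : stdSimplex.map (fun j ↦ (g j).2) s = stdSimplex.map (fun j ↦ (g' j).2) s') :
    realizationPoint (prismSimplex H x g) s = realizationPoint (prismSimplex H x g') s' := by
  refine stdSimplex.eq_of_map_eq (fun m g s ↦ realizationPoint (prismSimplex H x g) s)
    (fun m m' θ g s ↦ ?_) g s g' s' (stdSimplex.eq_of_marginals_eq
      (stdSimplex.le_of_map_pos g s) (stdSimplex.le_of_map_pos g' s') ?_ ?_)
  · rw [prismSimplex_comp, realizationPoint_map]
    rfl
  · rw [stdSimplex.map_comp_apply, stdSimplex.map_comp_apply]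
    exact h₁
  · rw [stdSimplex.map_comp_apply, stdSimplex.map_comp_apply]
    exact h₂

/-- The continuous map on the product of a simplex of `X` with the interval induced by `H`. -/
lemma exists_prismMap {n : ℕ} (x : X _⦋n⦌) :
    ∃ ψ : C(_root_.stdSimplex ℝ (Fin (n + 1)) × _root_.stdSimplex ℝ (Fin 2), toTop.obj Y),
      ∀ (m : ℕ) (g : Fin (m + 1) →o Fin (n + 1) × Fin 2) (s : _root_.stdSimplex ℝ (Fin (m + 1))),
        ψ (stdSimplex.map (fun j ↦ (g j).1) s, stdSimplex.map (fun j ↦ (g j).2) s) =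
          realizationPoint (prismSimplex H x g) s := by
  have : Finite (Fin (n + 2) →o Fin (n + 1) × Fin 2) := DFunLike.finite _
  obtain ⟨ψ, hψ⟩ := ContinuousMap.exists_of_jointly_surjective
    (fun g : Fin (n + 2) →o Fin (n + 1) × Fin 2 ↦
      (⟨_, stdSimplex.continuous_map fun j ↦ (g j).1⟩ : C(_, _)).prodMk
        ⟨_, stdSimplex.continuous_map fun j ↦ (g j).2⟩)
    (fun ⟨t, c⟩ ↦ by
      obtain ⟨g, s, h₁, h₂⟩ := stdSimplex.exists_prism t c
      exact ⟨g, s, Prod.ext h₁ h₂⟩)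
    (fun g ↦ realizationPoint (prismSimplex H x g))
    (fun g g' s s' h ↦ realizationPoint_prismSimplex_eq H x g s g' s'
      (congrArg Prod.fst h) (congrArg Prod.snd h))
  refine ⟨ψ, fun m g s ↦ ?_⟩
  -- ψ was built from maximal chains only; an arbitrary chain is compared with a maximal one through
  -- the same point of the prism.
  obtain ⟨g', s', h₁, h₂⟩ := stdSimplex.exists_prism (stdSimplex.map (fun j ↦ (g j).1) s)
    (stdSimplex.map (fun j ↦ (g j).2) s)
  rw [← h₁, ← h₂]
  exact (hψ g' s').trans (realizationPoint_prismSimplex_eq H x _ _ _ _ h₁ h₂)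

/-- The realization of simplicially homotopic maps are homotopic. -/
theorem toTop_map_homotopic {f g : X ⟶ Y} (hf : ι₀ ≫ H = f) (hg : ι₁ ≫ H = g) :
    (toTop.map f).hom.Homotopic (toTop.map g).hom := by
  choose ψ hψ using fun (n : ℕ) (x : X _⦋n⦌) ↦ exists_prismMap H x
  -- With values in the mapping space, gluing needs only the universal property of |X|, not a
  -- comparison of |X × Δ[1]| with |X| × |Δ[1]|.
  obtain ⟨F, hF⟩ := exists_toTop_hom
    (Z := TopCat.of C(_root_.stdSimplex ℝ (Fin 2), toTop.obj Y)) (fun n x ↦ (ψ n x).curry) (by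
      intro m n θ x t
      ext c
      obtain ⟨g, s, rfl, rfl⟩ := stdSimplex.exists_prism t c
      refine (hψ _ _ _ g s).trans ?_
      rw [prismSimplex_map, ← hψ, stdSimplex.map_comp_apply]
      rfl)
  have key (c : Fin 2) (k : X ⟶ Y) (hk : ∀ n (x : X _⦋n⦌),
      prismSimplex H x (OrderHom.prod OrderHom.id (OrderHom.const _ c)) = k.app _ x)
      (p : toTop.obj X) : (F p : C(_root_.stdSimplex ℝ (Fin 2), toTop.obj Y))
        (stdSimplex.vertex c) = toTop.map k p := by
    let e : TopCat.of C(_root_.stdSimplex ℝ (Fin 2), toTop.obj Y) ⟶ toTop.obj Y :=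
      TopCat.ofHom ⟨fun q ↦ q (stdSimplex.vertex c), continuous_eval_const _⟩
    have : F ≫ e = toTop.map k := toTop_hom_ext fun n x s ↦ by
      rw [toTop_map_realizationPoint, ← hk]
      change (F (realizationPoint x s) : C(_root_.stdSimplex ℝ (Fin 2), toTop.obj Y))
        (stdSimplex.vertex c) = _
      rw [hF, ← hψ]
      refine congrArg (ψ n x) (Prod.ext (stdSimplex.map_id_apply s).symm ?_)
      exact (stdSimplex.map_const_apply c s).symm
    exact ConcreteCategory.congr_hom this p
  refine ⟨{ toFun q := (F q.2 : C(_root_.stdSimplex ℝ (Fin 2), toTop.obj Y))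
              (stdSimplexHomeomorphUnitInterval.symm q.1)
            continuous_toFun := ?_
            map_zero_left p := ?_
            map_one_left p := ?_ }⟩
  -- Evaluation is jointly continuous because Δ¹ is compact Hausdorff.
  · have : Continuous fun p : toTop.obj X ↦ (F p : C(_root_.stdSimplex ℝ (Fin 2), toTop.obj Y)) :=
      F.hom.continuous
    fun_prop
  · rw [stdSimplexHomeomorphUnitInterval_symm_zero]
    exact key 0 f (fun n x ↦ by
      rw [← hf]
      exact congrArg (H.app (op ⦋n⦌)) (Prod.ext (ConcreteCategory.congr_hom (X.map_id _) x) rfl)) p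
  · rw [stdSimplexHomeomorphUnitInterval_symm_one]
    exact key 1 g (fun n x ↦ by
      rw [← hg]
      exact congrArg (H.app (op ⦋n⦌)) (Prod.ext (ConcreteCategory.congr_hom (X.map_id _) x) rfl)) p

end Homotopy

/-- A simplicial set whose identity is simplicially homotopic to a constant map has a contractible
realization. -/
theorem contractibleSpace_toTop {X : SSet.{u}} (H : X ⊗ Δ[1] ⟶ X) (x₀ : X _⦋0⦌)
    (h₀ : ι₀ ≫ H = 𝟙 X) (h₁ : ι₁ ≫ H = const x₀) : ContractibleSpace (toTop.obj X) := by
  rw [contractible_iff_id_nullhomotopic]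
  refine ⟨realizationPoint x₀ default, ?_⟩
  have h := toTop_map_homotopic H h₀ h₁
  have e₁ : (toTop.map (const x₀ : X ⟶ X)).hom =
      ContinuousMap.const _ (realizationPoint x₀ default) := by
    refine congrArg TopCat.Hom.hom (toTop_hom_ext (f := toTop.map (const x₀ : X ⟶ X))
      (g := TopCat.ofHom (ContinuousMap.const _ (realizationPoint x₀ default)))
      fun n x s ↦ ?_)
    rw [toTop_map_realizationPoint]
    refine (realizationPoint_map (SimplexCategory.const _ _ 0) x₀ s).trans ?_
    exact congrArg _ (Subsingleton.elim (α := _root_.stdSimplex ℝ (Fin 1)) _ _)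
  rwa [e₁, CategoryTheory.Functor.map_id] at h

end SSet

/-! ### Contraction of the nerve of B ↓ b -/

/-- The constant geometric simplex at an object. -/
def GeomSimplex.const {C : Type u} [Bicategory.{w, v} C] (c : C) (n : ℕ) : GeomSimplex C n where
  obj _ := c
  map _ := 𝟙 c
  map₂ _ := 𝟙 (𝟙 c)
  mapId _ := 𝟙 (𝟙 c)
  mapComp _ _ := (λ_ (𝟙 c)).hom
  map₂_rightUnitor _ := by simp [unitors_equal]

namespace CommaBicat

open MonoidalCategory Simplicial

variable {B : Type u} [Bicategory.{w, v} B] {b : B}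

/-- The indicator of the vertex `1`. -/
def isOne : Fin 2 →o Bool where
  toFun i := i = 1
  monotone' := by decide

/-- The simplicial homotopy from the identity of the nerve of `B ↓ b` to a constant map. -/
def nerveContraction (b : B) :
    geometricNerve (CommaBicat b) ⊗ Δ[1] ⟶ geometricNerve (CommaBicat b) where
  app n := ↾fun p ↦ GeomSimplex.cone (n := n.unop.len) p.1
    (isOne.comp (SSet.stdSimplex.objEquiv p.2).toOrderHom)
  naturality _ _ _ := rfl

end CommaBicat

theorem mainTheorem7 {B : Type u} [Bicategory.{w, v} B] (b : B) :
    ContractibleSpace (classifyingSpace (CommaBicat b)) := by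
  -- Over 1 the cone does not depend on z, but its constraints are composites such as 𝟙 ≫ 𝟙. Taking
  -- the cone of a constant simplex as base vertex, rather than the constant simplex itself, makes
  -- the second end agree by `rfl`.
  refine SSet.contractibleSpace_toTop (CommaBicat.nerveContraction b)
    ((GeomSimplex.const (CommaBicat.apex b) 0).cone (OrderHom.const _ true)) ?_ ?_
  · ext n z
    exact GeomSimplex.cone_false z
  · ext n z
    rfl
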